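/- All Hilbert spaces are complex. For a contraction $A\colon \mathcal{H}_1\to\mathcal{H}_2$ between Hilbert spaces let $D_A=(I-A^*A)^{1/2}$ be its defect operator and $\mathcal{D}_A=\overline{D_A\mathcal{H}_1}$ its defect space. For contractions $A,B\colon\mathcal{H}_1\to\mathcal{H}_2$ say that $A$ Shmul'yan dominates $B$ if $B=A+D_{A^*}XD_A$ for some bounded operator $X\colon\mathcal{D}_A\to\mathcal{D}_{A^*}$; the Shmul'yan part $\Delta_{\rm Sh}(A)$ is the set of all contractions $B\colon\mathcal{H}_1\to\mathcal{H}_2$ such that $A$ and $B$ Shmul'yan dominate each other. For separable Hilbert spaces $\mathcal{E},\mathcal{E}'$ let $H_1^\infty(\mathcal{E},\mathcal{E}')$ be the set of analytic functions $F$ on the open unit disc $\mathbb{D}$ whose values are contractions from $\mathcal{E}$ to $\mathcal{E}'$, let $H^2(\mathcal{E})$ be the Hardy space of functions $g(\lambda)=\sum_{n\ge 0}\lambda^n g_n$ ($\lambda\in\mathbb{D}$, $g_n\in\mathcal{E}$) with $\|g\|^2=\sum_n\|g_n\|^2<\infty$, and for $F\in H_1^\infty(\mathcal{E},\mathcal{E}')$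 let $T_F\colon H^2(\mathcal{E})\to H^2(\mathcal{E}')$ be the contraction $(T_Fg)(\lambda)=F(\lambda)g(\lambda)$. Say that $F\in H_1^\infty(\mathcal{E},\mathcal{E}')$ Shmul'yan–ter Horst dominates $G\in H_1^\infty(\mathcal{E},\mathcal{E}')$ if $T_F$ Shmul'yan dominates $T_G$. **Theorem.** Let $\mathcal{E},\mathcal{E}'$ be separable Hilbert spaces and let $T\colon\mathcal{E}\to\mathcal{E}'$ be a partial isometry (a bounded operator with $TT^*T=T$). Then the constant function $\lambda\mapsto T$ in $H_1^\infty(\mathcal{E},\mathcal{E}')$ Shmul'yan–ter Horst dominates every $G\in H_1^\infty(\mathcal{E},\mathcal{E}')$ with $G(\mathbb{D})\subset\Delta_{\rm Sh}(T)$. -/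

import Mathlib

open scoped InnerProductSpace

set_option linter.unusedSectionVars false

noncomputable section

/-! ### Defect operators and the Shmul'yan pre-order -/

section Shmulyan

variable {H₁ H₂ : Type*}
  [NormedAddCommGroup H₁] [InnerProductSpace ℂ H₁] [CompleteSpace H₁]
  [NormedAddCommGroup H₂] [InnerProductSpace ℂ H₂] [CompleteSpace H₂]

/-- `T` is a partial isometry: `T T* T = T`. -/
def IsPartialIsometry (T : H₁ →L[ℂ] H₂) : Prop :=
  T ∘L ContinuousLinearMap.adjoint T ∘L T = T

/-- The defect operator `D_T = (I - T* T)^{1/2}` of a contraction `T`. -/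
def defectOp (T : H₁ →L[ℂ] H₂) : H₁ →L[ℂ] H₁ :=
  CFC.sqrt (ContinuousLinearMap.id ℂ H₁ - ContinuousLinearMap.adjoint T ∘L T)

/-- The defect space of `T`: the closure of the range of `D_T`. -/
def defectSpace (T : H₁ →L[ℂ] H₂) : Submodule ℂ H₁ :=
  (LinearMap.range (defectOp T).toLinearMap).topologicalClosure

theorem defectOp_mem_defectSpace (T : H₁ →L[ℂ] H₂) (h : H₁) :
    defectOp T h ∈ defectSpace T :=
  Submodule.le_topologicalClosure _ ⟨h, rfl⟩

/-- `D_T` as an operator from `H₁` into the defect space. -/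
def defectOpInto (T : H₁ →L[ℂ] H₂) : H₁ →L[ℂ] defectSpace T :=
  (defectOp T).codRestrict (defectSpace T) (defectOp_mem_defectSpace T)

/-- `D_T` as an operator from the defect space into `H₁`. -/
def defectOpFrom (T : H₁ →L[ℂ] H₂) : defectSpace T →L[ℂ] H₁ :=
  defectOp T ∘L (defectSpace T).subtypeL

/-- `ShmulyanDominated B A`: the contraction `B` is Shmul'yan dominated by the contraction `A`,
i.e. `B = A + D_{A*} X D_A` for a bounded operator `X` between the defect spaces. -/
def ShmulyanDominated (B A : H₁ →L[ℂ] H₂) : Prop :=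
  ‖A‖ ≤ 1 ∧ ‖B‖ ≤ 1 ∧
    ∃ X : defectSpace A →L[ℂ] defectSpace (ContinuousLinearMap.adjoint A),
      B = A + defectOpFrom (ContinuousLinearMap.adjoint A) ∘L X ∘L defectOpInto A

/-- The Shmul'yan part of `T`: the contractions Shmul'yan equivalent to `T`. -/
def shmulyanPart (T : H₁ →L[ℂ] H₂) : Set (H₁ →L[ℂ] H₂) :=
  {B | ShmulyanDominated B T ∧ ShmulyanDominated T B}

theorem IsPartialIsometry.norm_le_one {T : H₁ →L[ℂ] H₂} (hT : IsPartialIsometry T) :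
    ‖T‖ ≤ 1 := by
  by_contra! h
  have h1 : ‖T‖ * ‖T‖ ≤ ‖T‖ := by
    rw [← ContinuousLinearMap.norm_adjoint_comp_self]
    have h2 : (ContinuousLinearMap.adjoint T ∘L T) ∘L (ContinuousLinearMap.adjoint T ∘L T)
        = ContinuousLinearMap.adjoint T ∘L T := by
      rw [ContinuousLinearMap.comp_assoc]
      exact congrArg _ hT
    have h3 := ContinuousLinearMap.norm_adjoint_comp_self (ContinuousLinearMap.adjoint T ∘L T)
    rw [ContinuousLinearMap.adjoint_comp, ContinuousLinearMap.adjoint_adjoint, h2] at h3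
    nlinarith [norm_nonneg (ContinuousLinearMap.adjoint T ∘L T),
      ContinuousLinearMap.norm_adjoint_comp_self T]
  nlinarith

end Shmulyan

/-! ### Vector-valued Hardy space -/

section Hardy

/-- The Hardy space `H²(E)` on the unit disc. An element `g` is given by its square-summable
sequence of Taylor coefficients `g n`; as a function on the disc it is `hardyEval g`.
The norm is `‖g‖² = ∑ ‖g n‖²`. -/
abbrev HardySpace (E : Type*) [NormedAddCommGroup E] [InnerProductSpace ℂ E] : Type _ :=
  lp (fun _ : ℕ => E) 2

variable {E E' : Type*}
  [NormedAddCommGroup E] [InnerProductSpace ℂ E] [CompleteSpace E]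
  [NormedAddCommGroup E'] [InnerProductSpace ℂ E'] [CompleteSpace E']

/-- The analytic function on the unit disc represented by an element of `H²(E)`:
`g(z) = ∑ zⁿ gₙ`. -/
def hardyEval (g : HardySpace E) (z : ℂ) : E := ∑' n : ℕ, z ^ n • g n

theorem hardy_integral_fourier (n : ℤ) :
    ∫ x : UnitAddCircle, fourier n x ∂AddCircle.haarAddCircle = if n = 0 then 1 else 0 := by
  split_ifs with h
  · subst h
    simp
  · exact MeasureTheory.integral_eq_zero_of_add_right_eq_neg
      (fourier_add_half_inv_index h one_pos)

/-- Parseval's identity on the unit circle for absolutely summable coefficients. -/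
theorem hardy_parseval {a : ℕ → E} (ha : Summable fun n => ‖a n‖) :
    HasSum (fun n => ‖a n‖ ^ 2)
      (∫ x : UnitAddCircle, ‖∑' n : ℕ, (fourier 1 x) ^ n • a n‖ ^ 2
        ∂AddCircle.haarAddCircle) := by
  set μ : MeasureTheory.Measure UnitAddCircle := AddCircle.haarAddCircle with hμ
  have hw : ∀ x : UnitAddCircle, ‖fourier 1 x‖ = 1 := fun x => by
    rw [fourier_apply, Circle.norm_coe]
  have hwn : ∀ (x : UnitAddCircle) (n : ℕ), (fourier 1 x) ^ n = fourier (n : ℤ) x := by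
    intro x n
    induction n with
    | zero => simp
    | succ k ih => rw [pow_succ, ih, ← fourier_add]; push_cast; rfl
  have hnorm : ∀ (x : UnitAddCircle) (n : ℕ), ‖(fourier 1 x) ^ n • a n‖ = ‖a n‖ := by
    intro x n
    rw [norm_smul, norm_pow, hw, one_pow, one_mul]
  have hcontn : ∀ n : ℕ, Continuous fun x : UnitAddCircle => (fourier 1 x) ^ n • a n :=
    fun n => ((map_continuous (fourier 1)).pow n).smul continuous_const
  set f : UnitAddCircle → E := fun x => ∑' n : ℕ, (fourier 1 x) ^ n • a n with hf
  have hfc : Continuous f :=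
    continuous_tsum hcontn ha fun n x => (hnorm x n).le
  have hint : ∀ {V : Type _} [NormedAddCommGroup V] {g : UnitAddCircle → V}, Continuous g →
      MeasureTheory.Integrable g μ := fun hg =>
    hg.integrable_of_hasCompactSupport (HasCompactSupport.of_compactSpace _)
  have hsumf : ∀ x, HasSum (fun n : ℕ => (fourier 1 x) ^ n • a n) (f x) := fun x =>
    (Summable.of_norm (by simpa only [hnorm] using ha)).hasSum
  -- Fourier coefficients of `f`
  have hcoef : ∀ n : ℕ, ∫ x, ((starRingEnd ℂ) (fourier 1 x ^ n)) • f x ∂μ = a n := by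
    intro n
    have h1 : HasSum (fun m : ℕ => ∫ x, ((starRingEnd ℂ) (fourier 1 x ^ n)) •
        ((fourier 1 x) ^ m • a m) ∂μ) (∫ x, ((starRingEnd ℂ) (fourier 1 x ^ n)) • f x ∂μ) := by
      refine MeasureTheory.hasSum_integral_of_dominated_convergence (fun m _ => ‖a m‖) ?_ ?_ ?_ ?_ ?_
      · intro m
        refine Continuous.aestronglyMeasurable ?_
        exact (Complex.continuous_conj.comp ((map_continuous (fourier 1)).pow n)).smul (hcontn m)
      · intro m
        refine Filter.Eventually.of_forall fun x => ?_
        rw [norm_smul, hnorm, RCLike.norm_conj, norm_pow, hw, one_pow, one_mul]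
      · exact Filter.Eventually.of_forall fun x => ha
      · exact MeasureTheory.integrable_const _
      · exact Filter.Eventually.of_forall fun x => (hsumf x).const_smul _
    have h2 : ∀ m : ℕ, ∫ x, ((starRingEnd ℂ) (fourier 1 x ^ n)) •
        ((fourier 1 x) ^ m • a m) ∂μ = if m = n then a n else 0 := by
      intro m
      have h3 : ∀ x : UnitAddCircle, ((starRingEnd ℂ) (fourier 1 x ^ n)) •
          ((fourier 1 x) ^ m • a m) = (fourier (-(n : ℤ) + m) x : ℂ) • a m := by
        intro x
        rw [hwn, hwn, ← fourier_neg, smul_smul, ← fourier_add]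
      simp_rw [h3]
      rw [integral_smul_const, hardy_integral_fourier]
      by_cases hmn : m = n
      · subst hmn; simp
      · rw [if_neg (by omega), if_neg hmn, zero_smul]
    simp_rw [h2] at h1
    exact h1.unique (hasSum_ite_eq n (a n))
  -- expand the squared norm
  have hexp : HasSum (fun n : ℕ => ∫ x, ⟪(fourier 1 x) ^ n • a n, f x⟫_ℂ ∂μ)
      (∫ x, ⟪f x, f x⟫_ℂ ∂μ) := by
    have hb : ∀ x, ‖f x‖ ≤ ∑' n, ‖a n‖ := fun x =>
      (norm_tsum_le_tsum_norm (by simpa only [hnorm] using ha)).trans_eq (by simp only [hnorm])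
    refine MeasureTheory.hasSum_integral_of_dominated_convergence
      (fun m _ => ‖a m‖ * ∑' n, ‖a n‖) ?_ ?_ ?_ ?_ ?_
    · intro m
      exact ((hcontn m).inner hfc).aestronglyMeasurable
    · intro m
      refine Filter.Eventually.of_forall fun x => (norm_inner_le_norm _ _).trans ?_
      rw [hnorm]
      exact mul_le_mul_of_nonneg_left (hb x) (norm_nonneg _)
    · exact Filter.Eventually.of_forall fun x => ha.mul_right _
    · exact MeasureTheory.integrable_const _
    · refine Filter.Eventually.of_forall fun x => ?_
      have h5 := (hsumf x).mapL (innerSLFlip ℂ (f x))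
      simpa [mul_comm] using h5
  have hterm : ∀ n : ℕ, ∫ x, ⟪(fourier 1 x) ^ n • a n, f x⟫_ℂ ∂μ = ((‖a n‖ ^ 2 : ℝ) : ℂ) := by
    intro n
    have h4 : ∀ x, ⟪(fourier 1 x) ^ n • a n, f x⟫_ℂ
        = ⟪a n, ((starRingEnd ℂ) (fourier 1 x ^ n)) • f x⟫_ℂ := by
      intro x
      rw [inner_smul_left, inner_smul_right]
    simp_rw [h4]
    rw [integral_inner, hcoef, inner_self_eq_norm_sq_to_K]
    · norm_cast
    · exact hint ((Complex.continuous_conj.comp ((map_continuous (fourier 1)).pow n)).smul hfc)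
  simp_rw [hterm, inner_self_eq_norm_sq_to_K] at hexp
  have h6 : (∫ x, ((‖f x‖ : ℂ)) ^ 2 ∂μ) = ((∫ x, ‖f x‖ ^ 2 ∂μ : ℝ) : ℂ) := by
    rw [← integral_complex_ofReal]
    push_cast
    rfl
  erw [h6] at hexp
  exact_mod_cast hexp

theorem hardy_summable_norm {c : ℕ → E} (hc : ∀ z ∈ Metric.ball (0 : ℂ) 1,
    Summable fun n : ℕ => z ^ n • c n) {r : ℝ} (hr0 : 0 ≤ r) (hr1 : r < 1) :
    Summable fun n : ℕ => ‖(r : ℂ) ^ n • c n‖ := by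
  obtain ⟨ρ, hrρ, hρ1⟩ := exists_between hr1
  have hρ0 : 0 < ρ := hr0.trans_lt hrρ
  have hs := hc (ρ : ℂ) (by simpa [abs_of_pos hρ0] using hρ1)
  obtain ⟨C, hC⟩ := hs.tendsto_atTop_zero.norm.bddAbove_range
  have hgeo : Summable fun n : ℕ => (r / ρ) ^ n :=
    summable_geometric_of_lt_one (by positivity) ((div_lt_one hρ0).2 hrρ)
  refine Summable.of_nonneg_of_le (fun n => norm_nonneg _) (fun n => ?_) (hgeo.mul_right C)
  have h1 : ‖(ρ : ℂ) ^ n • c n‖ ≤ C := hC ⟨n, rfl⟩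
  have h2 : ‖(r : ℂ) ^ n • c n‖ = (r / ρ) ^ n * ‖(ρ : ℂ) ^ n • c n‖ := by
    rw [norm_smul, norm_smul, norm_pow, norm_pow, Complex.norm_real, Complex.norm_real,
      Real.norm_of_nonneg hr0, Real.norm_of_nonneg hρ0.le, div_pow]
    field_simp
  rw [h2]
  gcongr

theorem hardyEval_hasSum (g : HardySpace E) {z : ℂ} (hz : z ∈ Metric.ball (0 : ℂ) 1) :
    HasSum (fun n : ℕ => z ^ n • g n) (hardyEval g z) := by
  have hz' : ‖z‖ < 1 := by simpa using hz
  refine Summable.hasSum (Summable.of_norm_bounded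
    ((summable_geometric_of_lt_one (norm_nonneg z) hz').mul_right ‖g‖) fun n => ?_)
  rw [norm_smul, norm_pow]
  gcongr
  exact lp.norm_apply_le_norm two_ne_zero g n

theorem hardyEval_differentiableOn (g : HardySpace E) :
    DifferentiableOn ℂ (hardyEval g) (Metric.ball (0 : ℂ) 1) := by
  intro z hz
  have hz' : ‖z‖ < 1 := by simpa using hz
  obtain ⟨r, hzr, hr1⟩ := exists_between hz'
  have hr0 : 0 ≤ r := (norm_nonneg z).trans hzr.le
  have h : DifferentiableOn ℂ (hardyEval g) (Metric.ball (0 : ℂ) r) := by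
    refine Complex.differentiableOn_tsum_of_summable_norm
      ((summable_geometric_of_lt_one hr0 hr1).mul_right ‖g‖) (fun n => ?_) Metric.isOpen_ball
      fun n w hw => ?_
    · exact ((differentiable_id.pow n).smul_const (g n)).differentiableOn
    · have hw' : ‖w‖ < r := by simpa using hw
      rw [norm_smul, norm_pow]
      gcongr
      exact lp.norm_apply_le_norm two_ne_zero g n
  exact (h.differentiableAt (Metric.isOpen_ball.mem_nhds (by simpa using hzr)))
    |>.differentiableWithinAt

/-- A power series that is pointwise dominated by a function of `H²` has square-summable
coefficients, with the corresponding norm estimate. -/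
theorem hardy_sum_le {c : ℕ → E'} {h : ℂ → E'} (g : HardySpace E)
    (hc : ∀ z ∈ Metric.ball (0 : ℂ) 1, HasSum (fun n : ℕ => z ^ n • c n) (h z))
    (hh : ∀ z ∈ Metric.ball (0 : ℂ) 1, ‖h z‖ ≤ ‖hardyEval g z‖) (s : Finset ℕ) :
    ∑ n ∈ s, ‖c n‖ ^ 2 ≤ ‖g‖ ^ 2 := by
  have hg2 : HasSum (fun n => ‖g n‖ ^ 2) (‖g‖ ^ 2) := by
    simpa using lp.hasSum_norm (p := 2) (by norm_num) g
  have key : ∀ r : ℝ, 0 ≤ r → r < 1 → ∑ n ∈ s, ‖(r : ℂ) ^ n • c n‖ ^ 2 ≤ ‖g‖ ^ 2 := by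
    intro r hr0 hr1
    have hw : ∀ x : UnitAddCircle, (r : ℂ) * fourier 1 x ∈ Metric.ball (0 : ℂ) 1 := by
      intro x
      rw [mem_ball_zero_iff, norm_mul, fourier_apply, Circle.norm_coe, Complex.norm_real,
        Real.norm_of_nonneg hr0, mul_one]
      exact hr1
    have hsc := hardy_summable_norm (fun z hz => (hc z hz).summable) hr0 hr1
    have hsg := hardy_summable_norm (fun z hz => (hardyEval_hasSum g hz).summable) hr0 hr1
    have hc1 := hardy_parseval hsc
    have hg1 := hardy_parseval hsg
    have e1 : ∀ x : UnitAddCircle, ∑' n : ℕ, (fourier 1 x) ^ n • ((r : ℂ) ^ n • c n)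
        = h (r * fourier 1 x) := fun x => by
      rw [← (hc _ (hw x)).tsum_eq]
      exact tsum_congr fun n => by rw [smul_smul, mul_pow, mul_comm]
    have e2 : ∀ x : UnitAddCircle, ∑' n : ℕ, (fourier 1 x) ^ n • ((r : ℂ) ^ n • g n)
        = hardyEval g (r * fourier 1 x) := fun x => by
      rw [← (hardyEval_hasSum g (hw x)).tsum_eq]
      exact tsum_congr fun n => by rw [smul_smul, mul_pow, mul_comm]
    simp_rw [e1] at hc1
    simp_rw [e2] at hg1
    have hle1 : (∫ x : UnitAddCircle, ‖h (r * fourier 1 x)‖ ^ 2 ∂AddCircle.haarAddCircle)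
        ≤ ∫ x : UnitAddCircle, ‖hardyEval g (r * fourier 1 x)‖ ^ 2
          ∂AddCircle.haarAddCircle := by
      refine MeasureTheory.integral_mono_of_nonneg
        (Filter.Eventually.of_forall fun x => by positivity) ?_
        (Filter.Eventually.of_forall fun x => ?_)
      · refine Continuous.integrable_of_hasCompactSupport ?_ (HasCompactSupport.of_compactSpace _)
        refine (Continuous.norm ?_).pow 2
        exact (hardyEval_differentiableOn g).continuousOn.comp_continuous
          (continuous_const.mul (map_continuous (fourier 1))) hw
      · have := hh _ (hw x)
        dsimp only
        gcongr
    have hle2 : (∫ x : UnitAddCircle, ‖hardyEval g (r * fourier 1 x)‖ ^ 2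
          ∂AddCircle.haarAddCircle) ≤ ‖g‖ ^ 2 := by
      refine hasSum_le (fun n => ?_) hg1 hg2
      rw [norm_smul, norm_pow, Complex.norm_real, Real.norm_of_nonneg hr0]
      gcongr
      exact mul_le_of_le_one_left (norm_nonneg _) (pow_le_one₀ hr0 hr1.le)
    exact (sum_le_hasSum s (fun n _ => by positivity) hc1).trans (hle1.trans hle2)
  have hcont : Continuous fun r : ℝ => ∑ n ∈ s, ‖(r : ℂ) ^ n • c n‖ ^ 2 := by fun_prop
  have hlim : Filter.Tendsto (fun r : ℝ => ∑ n ∈ s, ‖(r : ℂ) ^ n • c n‖ ^ 2)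
      (nhdsWithin 1 (Set.Iio 1)) (nhds (∑ n ∈ s, ‖c n‖ ^ 2)) := by
    have := (hcont.tendsto 1).mono_left (nhdsWithin_le_nhds (s := Set.Iio 1))
    simpa using this
  refine le_of_tendsto hlim ?_
  filter_upwards [Ioo_mem_nhdsLT (zero_lt_one' ℝ)] with r hr
  exact key r hr.1.le hr.2

/-- An element of `H²(E)` is determined by its values on the disc. -/
theorem hardyEval_ext {f g : HardySpace E}
    (h : ∀ z ∈ Metric.ball (0 : ℂ) 1, hardyEval f z = hardyEval g z) : f = g := by
  have hs : ∀ z ∈ Metric.ball (0 : ℂ) 1,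
      HasSum (fun n : ℕ => z ^ n • (f n - g n)) ((fun _ : ℂ => (0 : E)) z) := by
    intro z hz
    have := (hardyEval_hasSum f hz).sub (hardyEval_hasSum g hz)
    simpa only [h z hz, sub_self, smul_sub] using this
  have h0 := hardy_sum_le (0 : HardySpace E) hs (fun z _ => by simp)
  refine lp.ext (funext fun n => ?_)
  have h1 := h0 {n}
  rw [Finset.sum_singleton, norm_zero] at h1
  have h2 : ‖f n - g n‖ = 0 := by
    nlinarith [norm_nonneg (f n - g n)]
  exact sub_eq_zero.1 (norm_eq_zero.1 h2)

theorem hardyEval_add (f g : HardySpace E) {z : ℂ} (hz : z ∈ Metric.ball (0 : ℂ) 1) :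
    hardyEval (f + g) z = hardyEval f z + hardyEval g z := by
  refine (hardyEval_hasSum (f + g) hz).unique ?_
  simpa only [lp.coeFn_add, Pi.add_apply, smul_add] using
    (hardyEval_hasSum f hz).add (hardyEval_hasSum g hz)

theorem hardyEval_smul (a : ℂ) (g : HardySpace E) {z : ℂ} (hz : z ∈ Metric.ball (0 : ℂ) 1) :
    hardyEval (a • g) z = a • hardyEval g z := by
  refine (hardyEval_hasSum (a • g) hz).unique ?_
  have h := (hardyEval_hasSum g hz).const_smul a
  simp_rw [smul_comm a] at h
  exact h

end Hardy

/-! ### The operator-valued Schur class and Toeplitz operators -/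

section Schur

/-- The Schur class `H₁^∞(E, E')`: analytic functions on the open unit disc whose values are
contractions from `E` to `E'`. (Values of `toFun` outside the disc play no role.) -/
structure SchurClass (E E' : Type*)
    [NormedAddCommGroup E] [InnerProductSpace ℂ E] [CompleteSpace E]
    [NormedAddCommGroup E'] [InnerProductSpace ℂ E'] [CompleteSpace E'] where
  toFun : ℂ → E →L[ℂ] E'
  analytic : DifferentiableOn ℂ toFun (Metric.ball (0 : ℂ) 1)
  norm_le_one : ∀ z ∈ Metric.ball (0 : ℂ) 1, ‖toFun z‖ ≤ 1

variable {E E' : Type*}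
  [NormedAddCommGroup E] [InnerProductSpace ℂ E] [CompleteSpace E]
  [NormedAddCommGroup E'] [InnerProductSpace ℂ E'] [CompleteSpace E']

/-- A contraction viewed as a constant function in the Schur class. -/
def SchurClass.const (T : E →L[ℂ] E') (hT : ‖T‖ ≤ 1) : SchurClass E E' where
  toFun := fun _ => T
  analytic := differentiableOn_const T
  norm_le_one := fun _ _ => hT

theorem SchurClass.exists_mul (F : SchurClass E E') (g : HardySpace E) :
    ∃ f : HardySpace E', ‖f‖ ≤ ‖g‖ ∧
      ∀ z ∈ Metric.ball (0 : ℂ) 1, hardyEval f z = F.toFun z (hardyEval g z) := by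
  have hd : DifferentiableOn ℂ (fun z => F.toFun z (hardyEval g z)) (Metric.ball (0 : ℂ) 1) :=
    F.analytic.clm_apply (hardyEval_differentiableOn g)
  set c : ℕ → E' := fun n =>
    ((n.factorial : ℂ)⁻¹) • iteratedDeriv n (fun z => F.toFun z (hardyEval g z)) 0 with hc
  have hs : ∀ z ∈ Metric.ball (0 : ℂ) 1,
      HasSum (fun n : ℕ => z ^ n • c n) (F.toFun z (hardyEval g z)) := by
    intro z hz
    have := Complex.hasSum_taylorSeries_on_ball hd hz
    convert this using 2 with n
    rw [sub_zero, smul_comm]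
  have hle := hardy_sum_le g hs fun z hz =>
    ((F.toFun z).le_opNorm _).trans
      (mul_le_of_le_one_left (norm_nonneg _) (F.norm_le_one z hz))
  have hmem : Memℓp c 2 := memℓp_gen' (C := ‖g‖ ^ 2) fun s => by simpa using hle s
  refine ⟨⟨c, hmem⟩, ?_, fun z hz => (hs z hz).tsum_eq⟩
  exact lp.norm_le_of_forall_sum_le (by norm_num) (norm_nonneg _) fun s => by simpa using hle s

/-- The Toeplitz (multiplication) operator `T_F : H²(E) → H²(E')`,
`(T_F g)(z) = F(z) g(z)` for `z` in the disc; see `hardyEval_toeplitz`. -/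
def toeplitz (F : SchurClass E E') : HardySpace E →L[ℂ] HardySpace E' :=
  LinearMap.mkContinuous
    { toFun := fun g => (F.exists_mul g).choose
      map_add' := fun f g => hardyEval_ext fun z hz => by
        rw [hardyEval_add _ _ hz, (F.exists_mul (f + g)).choose_spec.2 z hz,
          (F.exists_mul f).choose_spec.2 z hz, (F.exists_mul g).choose_spec.2 z hz,
          hardyEval_add _ _ hz, map_add]
      map_smul' := fun a g => hardyEval_ext fun z hz => by
        rw [RingHom.id_apply, hardyEval_smul _ _ hz, (F.exists_mul (a • g)).choose_spec.2 z hz,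
          (F.exists_mul g).choose_spec.2 z hz, hardyEval_smul _ _ hz, map_smul] }
    1 fun g => by
      rw [one_mul]
      exact (F.exists_mul g).choose_spec.1

/-- The defining property of the Toeplitz operator; by `hardyEval_ext` it determines `T_F`. -/
theorem hardyEval_toeplitz (F : SchurClass E E') (g : HardySpace E) {z : ℂ}
    (hz : z ∈ Metric.ball (0 : ℂ) 1) :
    hardyEval (toeplitz F g) z = F.toFun z (hardyEval g z) :=
  (F.exists_mul g).choose_spec.2 z hz

theorem norm_toeplitz_le_one (F : SchurClass E E') : ‖toeplitz F‖ ≤ 1 :=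
  LinearMap.mkContinuous_norm_le _ zero_le_one _

/-- `F` is Shmul'yan-ter Horst dominated by `G`: `T_F` is Shmul'yan dominated by `T_G`. -/
def ShmulyanTerHorstDominated (F G : SchurClass E E') : Prop :=
  ShmulyanDominated (toeplitz F) (toeplitz G)

end Schur

end

/-! ### Shmul'yan domination by a partial isometry -/

section PartialIsometry

variable {H₁ H₂ : Type*}
  [NormedAddCommGroup H₁] [InnerProductSpace ℂ H₁] [CompleteSpace H₁]
  [NormedAddCommGroup H₂] [InnerProductSpace ℂ H₂] [CompleteSpace H₂]

/-! For a partial isometry `A` the defect operators are the orthogonal projections onto `ker A` and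
`ker A*`. Domination of a contraction `B` by `A` therefore involves no estimate on `X`: it reduces
to the linear identities `A* B = A* A` and `B A* = A A*`
(`IsPartialIsometry.shmulyanDominated_iff`). Multiplication by the constant `T` acts coefficientwise
on the Hardy space, so it is again a partial isometry and its adjoint is multiplication by the
constant `T*` (`IsPartialIsometry.toeplitz_const`, `adjoint_toeplitz_const`). The identities
required of `T_G` then hold because, evaluated at each point `z` of the disc, they are the
identities for `G(z)`. -/

theorem IsPartialIsometry.apply {T : H₁ →L[ℂ] H₂} (hT : IsPartialIsometry T) (x : H₁) :
    T (ContinuousLinearMap.adjoint T (T x)) = T x :=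
  DFunLike.congr_fun hT x

theorem IsPartialIsometry.adjoint {T : H₁ →L[ℂ] H₂} (hT : IsPartialIsometry T) :
    IsPartialIsometry (ContinuousLinearMap.adjoint T) := by
  have h := congrArg ContinuousLinearMap.adjoint hT
  simpa only [IsPartialIsometry, ContinuousLinearMap.adjoint_comp,
    ContinuousLinearMap.adjoint_adjoint, ContinuousLinearMap.comp_assoc] using h

/-- The defect operator of a partial isometry is the projection `I - T* T`. -/
theorem IsPartialIsometry.defectOp_eq {T : H₁ →L[ℂ] H₂} (hT : IsPartialIsometry T) :
    defectOp T = ContinuousLinearMap.id ℂ H₁ - ContinuousLinearMap.adjoint T ∘L T := by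
  set P := ContinuousLinearMap.id ℂ H₁ - ContinuousLinearMap.adjoint T ∘L T with hP
  have hsa : ContinuousLinearMap.adjoint P = P := by
    simp [hP, ContinuousLinearMap.adjoint_comp, ContinuousLinearMap.adjoint_id]
  have hmul : P * P = P := by
    ext x
    simp [hP, hT.apply]
  -- A self-adjoint idempotent satisfies `P = P* P`, hence is positive; being its own square, it is
  -- then its own positive square root.
  have hnonneg : 0 ≤ P := by
    have h := star_mul_self_nonneg P
    rwa [ContinuousLinearMap.star_eq_adjoint, hsa, hmul] at h
  exact CFC.sqrt_unique hmul hnonneg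

theorem IsPartialIsometry.defectOp_apply {T : H₁ →L[ℂ] H₂} (hT : IsPartialIsometry T) (x : H₁) :
    defectOp T x = x - ContinuousLinearMap.adjoint T (T x) := by
  simp [hT.defectOp_eq]

/-- A contraction `B` is Shmul'yan dominated by a partial isometry `A` exactly when `B - A` maps
into `ker A*` and vanishes on the range of `A*`. -/
theorem IsPartialIsometry.shmulyanDominated_iff {A B : H₁ →L[ℂ] H₂} (hA : IsPartialIsometry A)
    (hB : ‖B‖ ≤ 1) :
    ShmulyanDominated B A ↔
      (∀ x, ContinuousLinearMap.adjoint A (B x) = ContinuousLinearMap.adjoint A (A x)) ∧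
        ∀ y, B (ContinuousLinearMap.adjoint A y) = A (ContinuousLinearMap.adjoint A y) := by
  constructor
  · rintro ⟨-, -, X, rfl⟩
    refine ⟨fun x => ?_, fun y => ?_⟩
    · have h : ∀ y, ContinuousLinearMap.adjoint A
          (defectOp (ContinuousLinearMap.adjoint A) y) = 0 := fun y => by
        rw [hA.adjoint.defectOp_apply, map_sub, hA.adjoint.apply, sub_self]
      simp [defectOpFrom, h]
    · have h : defectOpInto A (ContinuousLinearMap.adjoint A y) = 0 := by
        have := hA.adjoint.apply y
        rw [ContinuousLinearMap.adjoint_adjoint] at this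
        refine Subtype.ext ?_
        change defectOp A (ContinuousLinearMap.adjoint A y) = 0
        rw [hA.defectOp_apply, this, sub_self]
      simp [h]
  · rintro ⟨h₁, h₂⟩
    -- The witness `X` is `B - A` restricted to the defect space of `A`. The extra factor `D_{A*}`
    -- only serves to land in the defect space of `A*`; it is harmless because both defect
    -- projections fix `B - A` (`h₃` on the right, `h₄` on the left).
    refine ⟨hA.norm_le_one, hB,
      defectOpInto (ContinuousLinearMap.adjoint A) ∘L (B - A) ∘L (defectSpace A).subtypeL, ?_⟩
    have h₃ : ∀ x, (B - A) (defectOp A x) = (B - A) x := fun x => by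
      rw [hA.defectOp_apply, map_sub, sub_eq_self, sub_apply, h₂, sub_self]
    have h₄ : ∀ x, defectOp (ContinuousLinearMap.adjoint A) ((B - A) x) = (B - A) x := fun x => by
      rw [hA.adjoint.defectOp_apply, sub_apply, map_sub, h₁, sub_self,
        map_zero, sub_zero]
    ext x
    change B x = A x + defectOp (ContinuousLinearMap.adjoint A)
      (defectOp (ContinuousLinearMap.adjoint A) ((B - A) (defectOp A x)))
    rw [h₃, h₄, h₄, sub_apply, add_sub_cancel]

end PartialIsometry

/-! ### Toeplitz operators with constant symbol -/

section ToeplitzConst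

variable {E E' : Type*}
  [NormedAddCommGroup E] [InnerProductSpace ℂ E] [CompleteSpace E]
  [NormedAddCommGroup E'] [InnerProductSpace ℂ E'] [CompleteSpace E']

/-- A bounded operator passes through the convergent power series of `g`, and values on the disc
determine the coefficients. -/
theorem toeplitz_const_apply (T : E →L[ℂ] E') (hT : ‖T‖ ≤ 1) (g : HardySpace E) (n : ℕ) :
    toeplitz (SchurClass.const T hT) g n = T (g n) := by
  have hle : ∀ n, ‖T (g n)‖ ≤ ‖g n‖ := fun n =>
    (T.le_opNorm _).trans (mul_le_of_le_one_left (norm_nonneg _) hT)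
  have hmem : Memℓp (fun n => T (g n)) 2 := by
    refine memℓp_gen ((lp.memℓp g).summable (by norm_num) |>.of_nonneg_of_le
      (fun n => by positivity) fun n => ?_)
    gcongr
    exact hle n
  suffices h : toeplitz (SchurClass.const T hT) g = (⟨_, hmem⟩ : HardySpace E') by rw [h]
  refine hardyEval_ext fun z hz => ?_
  rw [hardyEval_toeplitz _ _ hz]
  refine HasSum.unique ?_ (hardyEval_hasSum _ hz)
  simpa [SchurClass.const] using (hardyEval_hasSum g hz).mapL T

/-- The Hardy space inner product is the sum of the inner products of coefficients, so the adjoint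
can be moved across term by term. This relies on the symbol being constant: for a general symbol the
adjoint is not a multiplication operator. -/
theorem adjoint_toeplitz_const (T : E →L[ℂ] E') (hT : ‖T‖ ≤ 1)
    (hT' : ‖ContinuousLinearMap.adjoint T‖ ≤ 1) :
    ContinuousLinearMap.adjoint (toeplitz (SchurClass.const T hT)) =
      toeplitz (SchurClass.const (ContinuousLinearMap.adjoint T) hT') := by
  refine ((ContinuousLinearMap.eq_adjoint_iff _ _).2 fun f g => ?_).symm
  rw [lp.inner_eq_tsum, lp.inner_eq_tsum]
  refine tsum_congr fun n => ?_
  rw [toeplitz_const_apply, toeplitz_const_apply, ContinuousLinearMap.adjoint_inner_left]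

theorem IsPartialIsometry.toeplitz_const {T : E →L[ℂ] E'} (hT : IsPartialIsometry T) :
    IsPartialIsometry (toeplitz (SchurClass.const T hT.norm_le_one)) := by
  rw [IsPartialIsometry, adjoint_toeplitz_const T _ hT.adjoint.norm_le_one]
  refine ContinuousLinearMap.ext fun g => lp.ext (funext fun n => ?_)
  simp only [ContinuousLinearMap.comp_apply, toeplitz_const_apply, hT.apply]

end ToeplitzConst

theorem mainTheorem8 {E E' : Type*}
    [NormedAddCommGroup E] [InnerProductSpace ℂ E] [CompleteSpace E]
    [TopologicalSpace.SeparableSpace E]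
    [NormedAddCommGroup E'] [InnerProductSpace ℂ E'] [CompleteSpace E']
    [TopologicalSpace.SeparableSpace E']
    (T : E →L[ℂ] E') (hT : IsPartialIsometry T)
    (G : SchurClass E E')
    (hG : ∀ z ∈ Metric.ball (0 : ℂ) 1, G.toFun z ∈ shmulyanPart T) :
    ShmulyanTerHorstDominated G (SchurClass.const T hT.norm_le_one) := by
  have key := fun z hz => (hT.shmulyanDominated_iff (G.norm_le_one z hz)).1 (hG z hz).1
  refine (hT.toeplitz_const.shmulyanDominated_iff (norm_toeplitz_le_one G)).2 ?_
  -- With the adjoint rewritten as a multiplication operator, every operator in the two identities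
  -- can be evaluated pointwise, and `key` applies to the vector at `z`.
  rw [adjoint_toeplitz_const T _ hT.adjoint.norm_le_one]
  refine ⟨fun g => hardyEval_ext fun z hz => ?_, fun g => hardyEval_ext fun z hz => ?_⟩
  · simp only [hardyEval_toeplitz _ _ hz]
    exact (key z hz).1 _
  · simp only [hardyEval_toeplitz _ _ hz]
    exact (key z hz).2 _
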